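/- Let $(X,\tau)$ be a Polish topological space and let $d:X\times X\to[0,\infty]$ be an extended distance (it satisfies the axioms of a distance but may take the value $\infty$) such that $(X,d)$ is complete, $d(x_h,x)\to0$ implies $x_h\to x$ in $\tau$, and $d$ is lower semicontinuous for $\tau\times\tau$. Let $\mathfrak m$ be a nonnegative $\sigma$-finite Borel measure on $X$, and let $V:X\to[0,\infty)$ be a Borel, $d$-Lipschitz function with $\int_X e^{-V^2}\,d\mathfrak m\le 1$ (for instance a sufficiently large constant if $\mathfrak m(X)<\infty$). Let $\mathscr P(X)$ be the set of Borel probability measures on $X$, equipped with the extended distance $$W_2(\mu,\nu)=\Big(\inf_{\gamma}\int_{X\times X}d^2(x,y)\,d\gamma(x,y)\Big)^{1/2},$$ where $\gamma$ runs through the couplings of $\mu$ and $\nu$, and put $\mathscr P_{[\mu]}(X)=\{\nu\in\mathscr P(X): W_2(\mu,\nu)<\infty\}$. Let $\mathrm{Ent}:\mathscr P(X)\to(-\infty,\infty]$ be the relative entropy: $\mathrm{Ent}(\mu)=\int_X\rho\log\rho\,d\mathfrak m$ if $\mu=\rho\,\mathfrak m$ and $\int_X V^2\,d\mu<\infty$,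 and $\mathrm{Ent}(\mu)=+\infty$ otherwise. For an extended metric space $(Y,d_Y)$ and $f:Y\to[-\infty,\infty]$ let $D(f)=\{f\in\mathbb R\}$, and let the descending slope be $$|\nabla^-f|(x)=\limsup_{y\to x}\frac{[f(y)-f(x)]^-}{d_Y(y,x)}\quad(x\in D(f)),$$ equal to $0$ if $x\in D(f)$ is isolated and to $+\infty$ if $x\notin D(f)$. A curve $\gamma$ is absolutely continuous on an interval $[a,b]$ if $d_Y(\gamma_s,\gamma_t)\le\int_s^t g(r)\,dr$ for all $a\le s\le t\le b$ and some $g\in L^1(a,b)$; its metric derivative $|\dot\gamma_t|=\lim_{s\to t}d_Y(\gamma_s,\gamma_t)/|s-t|$ then exists for a.e. $t$. A function $g:Y\to[0,\infty]$ is an upper gradient of $f$ if for every absolutely continuous curve $\gamma:[0,1]\to D(f)$ the function $s\mapsto g(\gamma_s)|\dot\gamma_s|$ (with $0\cdot\infty=0$) is Lebesgue measurable and $|f(\gamma_1)-f(\gamma_0)|\le\int_0^1 g(\gamma_s)|\dot\gamma_s|\,ds$. A metric gradient flow of $E:Y\to(-\infty,\infty]$ starting from $y_0\in D(E)$ is a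 curve $y:[0,\infty)\to D(E)$ with initial value $y_0$, absolutely continuous on $[0,T]$ for every $T>0$, such that $r\mapsto|\nabla^-E|(y_r)$ is Lebesgue measurable and $$E(y_0)=E(y_t)+\frac12\int_0^t|\dot y_r|^2\,dr+\frac12\int_0^t|\nabla^-E|^2(y_r)\,dr\qquad\text{for all }t\ge0.$$ Theorem (uniqueness of the gradient flow of the entropy). Suppose that the descending slope $|\nabla^-\mathrm{Ent}|$ of $\mathrm{Ent}$ in $(\mathscr P(X),W_2)$ is an upper gradient of $\mathrm{Ent}$, and let $\mu\in D(\mathrm{Ent})$. Then there is at most one metric gradient flow of $\mathrm{Ent}$ starting from $\mu$ in $(\mathscr P_{[\mu]}(X),W_2)$: any two such flows coincide at all times $t\ge 0$. -/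

import Mathlib

open MeasureTheory Filter Topology Set
open scoped ENNReal NNReal

noncomputable section

/-! ### Extended distances, slopes, absolutely continuous curves, gradient flows

The notions of this part are stated for a function `dY : Y → Y → ℝ≥0∞` (an extended distance on
`Y`) and a functional `f : Y → EReal`. Curves are functions `ℝ → Y` of which only the values on
the time interval under consideration matter. -/

/-- `d` is an extended distance on `X`. -/
structure IsExtendedDist {X : Type*} (d : X → X → ℝ≥0∞) : Prop where
  eq_zero_iff : ∀ x y, d x y = 0 ↔ x = y
  symm : ∀ x y, d x y = d y x
  triangle : ∀ x y z, d x y ≤ d x z + d z y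

/-- `(X, τ, d)` is a Polish extended space, where `τ` is the ambient topology of `X`. -/
structure IsPolishExtended {X : Type*} [TopologicalSpace X] (d : X → X → ℝ≥0∞) : Prop where
  polish : PolishSpace X
  dist : IsExtendedDist d
  complete : ∀ u : ℕ → X,
    (∀ ε : ℝ≥0∞, 0 < ε → ∃ N, ∀ i ≥ N, ∀ j ≥ N, d (u i) (u j) < ε) →
      ∃ x, Tendsto (fun n => d (u n) x) atTop (𝓝 0)
  tendsto : ∀ (u : ℕ → X) (x : X), Tendsto (fun n => d (u n) x) atTop (𝓝 0) →
    Tendsto u atTop (𝓝 x)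
  lsc : LowerSemicontinuous fun p : X × X => d p.1 p.2

/-- The effective domain `D(f)`: the points at which `f` is real. -/
def effectiveDomain {Y : Type*} (f : Y → EReal) : Set Y :=
  {y | f y ≠ ⊥ ∧ f y ≠ ⊤}

open scoped Classical in
/-- The descending slope `|∇⁻f|(x) = limsup_{y → x} [f(y) - f(x)]⁻ / d(y, x)`, with the limsup
written as the infimum over `r > 0` of suprema over the punctured `dY`-balls of radius `r`.
It is `0` at isolated points of `D(f)` and `∞` outside `D(f)`. -/
def descendingSlope {Y : Type*} (dY : Y → Y → ℝ≥0∞) (f : Y → EReal) (x : Y) : ℝ≥0∞ :=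
  if x ∈ effectiveDomain f then
    ⨅ (r : ℝ≥0∞) (_ : 0 < r), ⨆ (y : Y) (_ : 0 < dY y x ∧ dY y x < r),
      (f x - f y).toENNReal / dY y x
  else ⊤

/-- `γ` is absolutely continuous on the interval `[a, b]`. -/
def IsACCurveOn {Y : Type*} (dY : Y → Y → ℝ≥0∞) (γ : ℝ → Y) (a b : ℝ) : Prop :=
  ∃ g : ℝ → ℝ, IntegrableOn g (Icc a b) ∧
    ∀ s t, a ≤ s → s ≤ t → t ≤ b → dY (γ s) (γ t) ≤ ENNReal.ofReal (∫ r in s..t, g r)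

/-- The metric derivative `|γ'|(t) = lim_{s → t} d(γ_s, γ_t) / |s - t|`. The limit exists at
almost every time along an absolutely continuous curve; a `limsup` makes it total. -/
def metricDerivative {Y : Type*} (dY : Y → Y → ℝ≥0∞) (γ : ℝ → Y) (t : ℝ) : ℝ≥0∞ :=
  limsup (fun s => dY (γ s) (γ t) / ENNReal.ofReal |s - t|) (𝓝[≠] t)

/-- `g` is an upper gradient of `f` (in `ℝ≥0∞`, `0 * ∞ = 0`). -/
def IsUpperGradient {Y : Type*} (dY : Y → Y → ℝ≥0∞) (f : Y → EReal) (g : Y → ℝ≥0∞) : Prop :=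
  ∀ γ : ℝ → Y, IsACCurveOn dY γ 0 1 → (∀ t ∈ Icc (0 : ℝ) 1, γ t ∈ effectiveDomain f) →
    AEMeasurable (fun s => g (γ s) * metricDerivative dY γ s) (volume.restrict (Ioo 0 1)) ∧
      (f (γ 1) - f (γ 0)).abs ≤ ∫⁻ s in Ioo (0 : ℝ) 1, g (γ s) * metricDerivative dY γ s

/-- `y : [0, ∞) → D(E)` is a metric gradient flow of `E`: a locally absolutely continuous curve
along which the energy dissipation equality holds. The measurability clause says that the integral
of the squared slope makes sense. -/
structure IsMetricGradientFlow {Y : Type*} (dY : Y → Y → ℝ≥0∞) (E : Y → EReal) (y : ℝ → Y) :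
    Prop where
  mem_domain : ∀ t, 0 ≤ t → y t ∈ effectiveDomain E
  absCont : ∀ T, 0 < T → IsACCurveOn dY y 0 T
  slope_measurable :
    AEMeasurable (fun r => descendingSlope dY E (y r)) (volume.restrict (Ioi 0))
  energy_eq : ∀ t, 0 ≤ t →
    E (y 0) = E (y t) +
      (((1 / 2 : ℝ≥0∞) * ∫⁻ r in Ioo 0 t, metricDerivative dY y r ^ 2 : ℝ≥0∞) : EReal) +
      (((1 / 2 : ℝ≥0∞) * ∫⁻ r in Ioo 0 t, descendingSlope dY E (y r) ^ 2 : ℝ≥0∞) : EReal)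

/-! ### The Wasserstein distance and the relative entropy -/

/-- The Wasserstein distance `W₂` on Borel probability measures, for the cost `d²`; it may take
the value `∞`. -/
def wasserstein {X : Type*} [MeasurableSpace X] (d : X → X → ℝ≥0∞)
    (μ ν : ProbabilityMeasure X) : ℝ≥0∞ :=
  (⨅ (γ : Measure (X × X)) (_ : γ.fst = (μ : Measure X) ∧ γ.snd = (ν : Measure X)),
    ∫⁻ p, d p.1 p.2 ^ 2 ∂γ) ^ (1 / 2 : ℝ)

/-- The probability measures at finite Wasserstein distance from `μ`. -/
abbrev WassersteinClass {X : Type*} [MeasurableSpace X] (d : X → X → ℝ≥0∞)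
    (μ : ProbabilityMeasure X) : Type _ :=
  {ν : ProbabilityMeasure X // wasserstein d μ ν < ⊤}

/-- The assumptions on the weight `V : X → [0, ∞)` attached to the reference measure `m`:
`V` is Borel and `d`-Lipschitz, and `∫ exp (-V²) dm ≤ 1`. -/
structure IsReferenceWeight {X : Type*} [MeasurableSpace X] (d : X → X → ℝ≥0∞) (m : Measure X)
    (V : X → ℝ) : Prop where
  nonneg : ∀ x, 0 ≤ V x
  measurable : Measurable V
  lipschitz : ∃ C : ℝ≥0, ∀ x y, ENNReal.ofReal |V x - V y| ≤ C * d x y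
  integral_le : ∫⁻ x, ENNReal.ofReal (Real.exp (-(V x) ^ 2)) ∂m ≤ 1

open scoped Classical in
/-- The relative entropy: `∫ ρ log ρ dm` if `μ = ρ m` and `∫ V² dμ < ∞`, and `+∞` otherwise. The
integral is the difference of the integrals of the positive and of the negative part; the
latter is finite when `V` is a reference weight. -/
def relEntropy {X : Type*} [MeasurableSpace X] (m : Measure X) (V : X → ℝ)
    (μ : ProbabilityMeasure X) : EReal :=
  let ρ : X → ℝ := fun x => ((μ : Measure X).rnDeriv m x).toReal
  if (μ : Measure X) ≪ m ∧ ∫⁻ x, ENNReal.ofReal (V x ^ 2) ∂(μ : Measure X) < ⊤ then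
    ((∫⁻ x, ENNReal.ofReal (ρ x * Real.log (ρ x)) ∂m : ℝ≥0∞) : EReal) -
      ((∫⁻ x, ENNReal.ofReal (-(ρ x * Real.log (ρ x))) ∂m : ℝ≥0∞) : EReal)
  else ⊤

end

/-!
Given two gradient flows `y` and `z` with the same initial datum, consider the curve of midpoints
`σ t = (y t + z t) / 2`.

* The squared Wasserstein distance is convex under averaging of measures, hence so is the squared
  metric derivative: `|σ'|² ≤ (|y'|² + |z'|²) / 2` (`metricDerivative_probMidpoint_sq_le`).
* The squared descending slope of the entropy is convex under averaging as well
  (`descendingSlope_probMidpoint_sq_le`). No geodesic convexity of the entropy is involved. A plan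
  `γ` from a midpoint `(α + β) / 2` to `ν` splits, through its disintegration, into plans from `α`
  to some `α'` and from `β` to some `β'` with `(α' + β') / 2 = ν` (`exists_split_plan`). The entropy
  gap `Ent α + Ent β - 2 Ent ((α + β) / 2)` is the sum of the Kullback–Leibler divergences of `α`
  and `β` from their midpoint (`integral_llr_add_integral_llr`), and by the data processing
  inequality it does not increase when `α`, `β` are replaced by `α'`, `β'`. Thus the entropy drop
  along `γ` is at most the average of the drops along the two partial plans, which the slopes at
  `α` and `β` control (`exists_split_entropy_drop`).

As the slope is an upper gradient, the entropy loss of `σ` on `[0, T]` is at most the average of the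
losses of `y` and `z`, which are given by the energy dissipation equality
(`abs_relEntropy_probMidpoint_sub_le`). Since the three curves start at the same measure, this says
that `Ent (y T) + Ent (z T) ≤ 2 Ent (σ T)`. By the formula for the entropy gap, `y T` and `z T` have
zero divergence from `σ T`, so that both agree with it.

The Wasserstein distance is shown to be an extended distance (`wasserstein_isExtendedDist`): the
triangle inequality makes metric derivatives measurable and keeps the competitors in the slope
at finite distance from `μ`, while definiteness is needed because the slope ignores points at
distance zero.
-/

/-! ### The Wasserstein distance -/

section Wasserstein

variable {X : Type*} [MeasurableSpace X] {d : X → X → ℝ≥0∞}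

theorem wasserstein_sq (μ ν : ProbabilityMeasure X) :
    wasserstein d μ ν ^ 2 =
      ⨅ (γ : Measure (X × X)) (_ : γ.fst = (μ : Measure X) ∧ γ.snd = (ν : Measure X)),
        ∫⁻ p, d p.1 p.2 ^ 2 ∂γ := by
  rw [wasserstein, ← ENNReal.rpow_natCast, ← ENNReal.rpow_mul]
  norm_num

theorem wasserstein_sq_le {μ ν : ProbabilityMeasure X} {γ : Measure (X × X)}
    (h₁ : γ.fst = (μ : Measure X)) (h₂ : γ.snd = (ν : Measure X)) :
    wasserstein d μ ν ^ 2 ≤ ∫⁻ p, d p.1 p.2 ^ 2 ∂γ := by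
  rw [wasserstein_sq]
  exact iInf₂_le γ ⟨h₁, h₂⟩

theorem exists_plan_lt {μ ν : ProbabilityMeasure X} {c : ℝ≥0∞} (h : wasserstein d μ ν ^ 2 < c) :
    ∃ γ : Measure (X × X), γ.fst = (μ : Measure X) ∧ γ.snd = (ν : Measure X) ∧
      ∫⁻ p, d p.1 p.2 ^ 2 ∂γ < c := by
  rw [wasserstein_sq] at h
  simp only [iInf_lt_iff] at h
  obtain ⟨γ, ⟨h₁, h₂⟩, h₃⟩ := h
  exact ⟨γ, h₁, h₂, h₃⟩

theorem isProbabilityMeasure_of_fst {Y : Type*} [MeasurableSpace Y] {γ : Measure (X × Y)}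
    {μ : ProbabilityMeasure X} (h : γ.fst = (μ : Measure X)) : IsProbabilityMeasure γ :=
  ⟨by rw [← Measure.fst_univ, h, measure_univ]⟩

theorem ENNReal.le_of_sq_le_sq {a b : ℝ≥0∞} (h : a ^ 2 ≤ b ^ 2) : a ≤ b :=
  (ENNReal.pow_le_pow_left_iff two_ne_zero).1 h

theorem ENNReal.sq_rpow_half (a : ℝ≥0∞) : (a ^ (1 / 2 : ℝ)) ^ 2 = a := by
  rw [← ENNReal.rpow_natCast, ← ENNReal.rpow_mul]
  norm_num

theorem wasserstein_symm (hs : ∀ x y, d x y = d y x) (μ ν : ProbabilityMeasure X) :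
    wasserstein d μ ν = wasserstein d ν μ := by
  have key : ∀ μ ν : ProbabilityMeasure X, wasserstein d μ ν ≤ wasserstein d ν μ := by
    intro μ ν
    refine ENNReal.le_of_sq_le_sq (le_of_forall_gt fun c hc => ?_)
    obtain ⟨γ, h₁, h₂, h₃⟩ := exists_plan_lt hc
    refine lt_of_le_of_lt (wasserstein_sq_le (γ := γ.map MeasurableEquiv.prodComm) ?_ ?_)
      (lt_of_eq_of_lt ?_ h₃)
    · rw [← h₂, Measure.fst, Measure.map_map measurable_fst (MeasurableEquiv.measurable _)]
      rfl
    · rw [← h₁, Measure.snd, Measure.map_map measurable_snd (MeasurableEquiv.measurable _)]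
      rfl
    · rw [lintegral_map_equiv]
      exact lintegral_congr fun p => by rw [hs]; rfl
  exact le_antisymm (key μ ν) (key ν μ)

theorem wasserstein_self (hdm : Measurable fun p : X × X => d p.1 p.2) (h0 : ∀ x, d x x = 0)
    (μ : ProbabilityMeasure X) : wasserstein d μ μ = 0 := by
  have hm : Measurable fun x : X => (x, x) := by fun_prop
  have h := wasserstein_sq_le (d := d) (μ := μ) (ν := μ) (γ := (μ : Measure X).map fun x => (x, x))
    (by rw [Measure.fst, Measure.map_map measurable_fst hm]; exact Measure.map_id)
    (by rw [Measure.snd, Measure.map_map measurable_snd hm]; exact Measure.map_id)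
  rw [lintegral_map (hdm.pow_const 2) hm] at h
  simpa [h0] using h

/-- Two plans with a common marginal can be glued along it: disintegrate the second one. -/
theorem exists_gluing [StandardBorelSpace X] [Nonempty X] (γ₁ γ₂ : Measure (X × X))
    [IsProbabilityMeasure γ₁] [IsProbabilityMeasure γ₂] (h : γ₁.snd = γ₂.fst) :
    ∃ Γ : Measure ((X × X) × X),
      Γ.map Prod.fst = γ₁ ∧ Γ.map (fun p => (p.1.2, p.2)) = γ₂ := by
  refine ⟨γ₁.compProd (γ₂.condKernel.comap Prod.snd measurable_snd), ?_, ?_⟩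
  · exact Measure.fst_compProd _ _
  · have hm : Measurable fun p : (X × X) × X => (p.1.2, p.2) := by fun_prop
    refine Measure.ext_of_lintegral _ fun f hf => ?_
    rw [lintegral_map hf hm,
      Measure.lintegral_compProd (f := fun p : (X × X) × X => f (p.1.2, p.2)) (hf.comp hm)]
    conv_rhs => rw [← γ₂.disintegrate γ₂.condKernel, Measure.lintegral_compProd hf, ← h]
    rw [Measure.snd, lintegral_map (hf.lintegral_kernel_prod_right' (κ := γ₂.condKernel))
      measurable_snd]
    rfl

theorem wasserstein_triangle [StandardBorelSpace X]
    (hdm : Measurable fun p : X × X => d p.1 p.2) (ht : ∀ x y z, d x y ≤ d x z + d z y)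
    (μ ν ρ : ProbabilityMeasure X) :
    wasserstein d μ ρ ≤ wasserstein d μ ν + wasserstein d ν ρ := by
  have : Nonempty X := μ.nonempty
  have key : ∀ a b : ℝ≥0∞, wasserstein d μ ν < a → wasserstein d ν ρ < b →
      wasserstein d μ ρ ≤ a + b := by
    intro a b ha hb
    obtain ⟨γ₁, h₁, h₁', h₁''⟩ := exists_plan_lt (ENNReal.pow_lt_pow_left two_ne_zero ha)
    obtain ⟨γ₂, h₂, h₂', h₂''⟩ := exists_plan_lt (ENNReal.pow_lt_pow_left two_ne_zero hb)
    have := isProbabilityMeasure_of_fst h₁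
    have := isProbabilityMeasure_of_fst h₂
    obtain ⟨Γ, hΓ₁, hΓ₂⟩ := exists_gluing γ₁ γ₂ (h₁'.trans h₂.symm)
    have hm : Measurable fun p : (X × X) × X => (p.1.1, p.2) := by fun_prop
    have hm' : Measurable fun p : (X × X) × X => (p.1.2, p.2) := by fun_prop
    have hW := wasserstein_sq_le (d := d) (μ := μ) (ν := ρ) (γ := Γ.map fun p => (p.1.1, p.2))
      (by
        rw [← h₁, Measure.fst, Measure.map_map measurable_fst hm, ← hΓ₁, Measure.fst,
          Measure.map_map measurable_fst measurable_fst]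
        rfl)
      (by
        rw [← h₂', Measure.snd, Measure.map_map measurable_snd hm, ← hΓ₂, Measure.snd,
          Measure.map_map measurable_snd hm']
        rfl)
    rw [lintegral_map (hdm.pow_const 2) hm] at hW
    rw [← hΓ₁, lintegral_map (hdm.pow_const 2) measurable_fst] at h₁''
    rw [← hΓ₂, lintegral_map (hdm.pow_const 2) hm'] at h₂''
    have hMink := ENNReal.lintegral_Lp_add_le (μ := Γ) (p := 2)
      (f := fun p => d p.1.1 p.1.2) (g := fun p => d p.1.2 p.2)
      (hdm.comp measurable_fst).aemeasurable (hdm.comp hm').aemeasurable (by norm_num)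
    simp only [ENNReal.rpow_two, Pi.add_apply] at hMink
    calc wasserstein d μ ρ ≤ (∫⁻ p, (d p.1.1 p.1.2 + d p.1.2 p.2) ^ 2 ∂Γ) ^ (1 / 2 : ℝ) :=
          ENNReal.le_of_sq_le_sq (by
            rw [ENNReal.sq_rpow_half]
            exact hW.trans (lintegral_mono fun p => by dsimp only; gcongr; exact ht _ _ _))
      _ ≤ _ := hMink
      _ ≤ a + b := add_le_add
          (ENNReal.le_of_sq_le_sq (by rw [ENNReal.sq_rpow_half]; exact h₁''.le))
          (ENNReal.le_of_sq_le_sq (by rw [ENNReal.sq_rpow_half]; exact h₂''.le))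
  rcases eq_or_ne (wasserstein d μ ν) ∞ with h | h
  · simp [h]
  rcases eq_or_ne (wasserstein d ν ρ) ∞ with h' | h'
  · simp [h']
  refine ENNReal.le_of_forall_pos_le_add fun ε hε _ => ?_
  have hε' : (ε / 2 : ℝ≥0∞) ≠ 0 := by simp [hε.ne']
  calc wasserstein d μ ρ ≤ (wasserstein d μ ν + ε / 2) + (wasserstein d ν ρ + ε / 2) :=
        key _ _ (ENNReal.lt_add_right h hε') (ENNReal.lt_add_right h' hε')
    _ = wasserstein d μ ν + wasserstein d ν ρ + ε := by
        rw [add_add_add_comm, ENNReal.add_halves]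

/-- The midpoint `(μ + ν) / 2` of two probability measures. -/
noncomputable def probMidpoint (μ ν : ProbabilityMeasure X) : ProbabilityMeasure X :=
  ⟨(2⁻¹ : ℝ≥0∞) • ((μ : Measure X) + (ν : Measure X)), ⟨by
    simp only [Measure.smul_apply, Measure.add_apply, measure_univ, smul_eq_mul, one_add_one_eq_two]
    exact ENNReal.inv_mul_cancel two_ne_zero ENNReal.ofNat_ne_top⟩⟩

theorem coe_probMidpoint (μ ν : ProbabilityMeasure X) :
    (probMidpoint μ ν : Measure X) = (2⁻¹ : ℝ≥0∞) • ((μ : Measure X) + (ν : Measure X)) := rfl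

theorem probMidpoint_self (μ : ProbabilityMeasure X) : probMidpoint μ μ = μ := by
  refine Subtype.ext (Measure.ext fun s _ => ?_)
  change (2⁻¹ : ℝ≥0∞) * ((μ : Measure X) s + (μ : Measure X) s) = (μ : Measure X) s
  rw [← two_mul, ← mul_assoc, ENNReal.inv_mul_cancel two_ne_zero ENNReal.ofNat_ne_top, one_mul]

theorem ENNReal.le_inv_two_mul_add {S A B : ℝ≥0∞}
    (h : ∀ a b, A < a → B < b → S ≤ 2⁻¹ * (a + b)) : S ≤ 2⁻¹ * (A + B) := by
  rcases eq_or_ne A ∞ with hA | hA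
  · simp [hA, ENNReal.mul_top]
  rcases eq_or_ne B ∞ with hB | hB
  · simp [hB, ENNReal.mul_top]
  refine ENNReal.le_of_forall_pos_le_add fun ε hε _ => ?_
  have hε' : (ε : ℝ≥0∞) ≠ 0 := by simp [hε.ne']
  refine (h _ _ (ENNReal.lt_add_right hA hε') (ENNReal.lt_add_right hB hε')).trans_eq ?_
  rw [add_add_add_comm, ← two_mul (ε : ℝ≥0∞), mul_add, ← mul_assoc,
    ENNReal.inv_mul_cancel two_ne_zero ENNReal.ofNat_ne_top, one_mul]

theorem ENNReal.le_inv_two_mul_sq_add_sq {S A B : ℝ≥0∞}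
    (h : ∀ a b, A < a → B < b → S ≤ 2⁻¹ * (a ^ 2 + b ^ 2)) : S ≤ 2⁻¹ * (A ^ 2 + B ^ 2) := by
  have root : ∀ {A u : ℝ≥0∞}, A ^ 2 < u → A < u ^ (1 / 2 : ℝ) := fun {A u} hu =>
    (ENNReal.pow_lt_pow_left_iff two_ne_zero).1 (by rwa [ENNReal.sq_rpow_half])
  refine ENNReal.le_inv_two_mul_add fun a b ha hb => ?_
  have := h _ _ (root ha) (root hb)
  rwa [ENNReal.sq_rpow_half, ENNReal.sq_rpow_half] at this

/-- The squared Wasserstein distance is convex under averaging: average the plans. -/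
theorem wasserstein_probMidpoint_sq_le (μ μ' ν ν' : ProbabilityMeasure X) :
    wasserstein d (probMidpoint μ μ') (probMidpoint ν ν') ^ 2 ≤
      2⁻¹ * (wasserstein d μ ν ^ 2 + wasserstein d μ' ν' ^ 2) := by
  refine ENNReal.le_inv_two_mul_add fun a b ha hb => ?_
  obtain ⟨γ, h₁, h₂, h₃⟩ := exists_plan_lt ha
  obtain ⟨γ', h₁', h₂', h₃'⟩ := exists_plan_lt hb
  refine (wasserstein_sq_le (γ := (2⁻¹ : ℝ≥0∞) • (γ + γ')) ?_ ?_).trans ?_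
  · rw [coe_probMidpoint, ← h₁, ← h₁', Measure.fst, Measure.map_smul,
      Measure.map_add _ _ measurable_fst]
    rfl
  · rw [coe_probMidpoint, ← h₂, ← h₂', Measure.snd, Measure.map_smul,
      Measure.map_add _ _ measurable_snd]
    rfl
  · rw [lintegral_smul_measure, lintegral_add_measure, smul_eq_mul]
    gcongr

end Wasserstein

section Polish

variable {X : Type*} [TopologicalSpace X] [MeasurableSpace X] [BorelSpace X] {d : X → X → ℝ≥0∞}

theorem IsPolishExtended.measurable_dist (hd : IsPolishExtended d) :
    Measurable fun p : X × X => d p.1 p.2 :=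
  have := hd.polish
  hd.lsc.measurable

/-- If `W₂(μ, ν) = 0`, then `μ ≤ ν` on compact sets. Indeed, `d` is bounded away from `0` on `F × G`
for disjoint compact `F`, `G`, so that plans of small cost hardly transport mass from `F` to `G`. -/
theorem measure_le_of_wasserstein_eq_zero (hd : IsPolishExtended d) {μ ν : ProbabilityMeasure X}
    (h : wasserstein d μ ν = 0) {F : Set X} (hF : IsCompact F) :
    (μ : Measure X) F ≤ (ν : Measure X) F := by
  have := hd.polish
  refine ENNReal.le_of_forall_pos_le_add fun ε hε _ => ?_
  have hε' : (ε / 2 : ℝ≥0∞) ≠ 0 := by simp [hε.ne']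
  obtain ⟨G, hGF, hG, hG'⟩ := hF.measurableSet.compl.exists_isCompact_lt_add
    (μ := (ν : Measure X)) (measure_ne_top _ _) hε'
  obtain ⟨δ, hδ, hδd⟩ : ∃ δ : ℝ≥0∞, δ ≠ 0 ∧ ∀ x ∈ F, ∀ y ∈ G, δ ≤ d x y := by
    rcases (F ×ˢ G).eq_empty_or_nonempty with he | hne
    · refine ⟨1, one_ne_zero, fun x hx y hy => ?_⟩
      have : (x, y) ∈ F ×ˢ G := ⟨hx, hy⟩
      simp [he] at this
    · obtain ⟨p, hp, hpm⟩ :=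
        (hd.lsc.lowerSemicontinuousOn _).exists_isMinOn hne (hF.prod hG)
      refine ⟨d p.1 p.2, fun h0 => ?_, fun x hx y hy => hpm (show (x, y) ∈ F ×ˢ G from ⟨hx, hy⟩)⟩
      rw [hd.dist.eq_zero_iff] at h0
      exact hGF hp.2 (h0 ▸ hp.1)
  have hc : wasserstein d μ ν ^ 2 < δ ^ 2 * (ε / 2) := by
    rw [h, zero_pow two_ne_zero]
    exact pos_iff_ne_zero.2 (mul_ne_zero (pow_ne_zero 2 hδ) hε')
  obtain ⟨γ, h₁, h₂, h₃⟩ := exists_plan_lt hc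
  have hFm := hF.measurableSet
  have hGm := hG.measurableSet
  have hγ : γ (F ×ˢ G) ≤ ε / 2 := by
    have h4 : δ ^ 2 * γ (F ×ˢ G) ≤ ∫⁻ p, d p.1 p.2 ^ 2 ∂γ := by
      calc δ ^ 2 * γ (F ×ˢ G) = ∫⁻ _ in F ×ˢ G, δ ^ 2 ∂γ := by simp
        _ ≤ ∫⁻ p in F ×ˢ G, d p.1 p.2 ^ 2 ∂γ :=
          setLIntegral_mono' (hFm.prod hGm) fun p hp => by gcongr; exact hδd _ hp.1 _ hp.2
        _ ≤ _ := setLIntegral_le_lintegral _ _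
    have h5 : δ ^ 2 * γ (F ×ˢ G) < δ ^ 2 * (ε / 2) := h4.trans_lt h₃
    exact (lt_of_mul_lt_mul_left' h5).le
  calc (μ : Measure X) F = γ (F ×ˢ univ) := by
        rw [← h₁, Measure.fst_apply hFm, ← Set.prod_univ]
    _ ≤ γ (univ ×ˢ F ∪ (F ×ˢ G ∪ univ ×ˢ (Fᶜ \ G))) := measure_mono fun p hp => by
        by_cases h1 : p.2 ∈ F <;> by_cases h2 : p.2 ∈ G <;> simp_all
    _ ≤ γ (univ ×ˢ F) + (γ (F ×ˢ G) + γ (univ ×ˢ (Fᶜ \ G))) :=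
        (measure_union_le _ _).trans (by gcongr; exact measure_union_le _ _)
    _ ≤ (ν : Measure X) F + (ε / 2 + ε / 2) := by
        have e : ∀ {A : Set X}, MeasurableSet A → γ (univ ×ˢ A) = (ν : Measure X) A := fun hA => by
          rw [← h₂, Measure.snd_apply hA, ← Set.univ_prod]
        rw [e hFm, e (hFm.compl.diff hGm)]
        have : (ν : Measure X) (Fᶜ \ G) ≤ ε / 2 := by
          rw [measure_sdiff hGF hGm.nullMeasurableSet (measure_ne_top _ _)]
          exact tsub_le_iff_left.2 hG'.le
        gcongr
    _ = (ν : Measure X) F + ε := by rw [ENNReal.add_halves]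

theorem wasserstein_isExtendedDist (hd : IsPolishExtended d) :
    IsExtendedDist (wasserstein d) := by
  have := hd.polish
  have hsymm := wasserstein_symm hd.dist.symm
  refine ⟨fun μ ν => ⟨fun h => ?_, ?_⟩, hsymm, fun μ ν ρ =>
    wasserstein_triangle hd.measurable_dist hd.dist.triangle _ _ _⟩
  · have key : ∀ μ ν : ProbabilityMeasure X, wasserstein d μ ν = 0 →
        (μ : Measure X) ≤ (ν : Measure X) := by
      intro μ ν h
      refine Measure.le_iff.2 fun A hA => ?_
      rw [hA.measure_eq_iSup_isCompact_of_ne_top (measure_ne_top _ _)]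
      exact iSup₂_le fun K hK => iSup_le fun hK' =>
        (measure_le_of_wasserstein_eq_zero hd h hK').trans (measure_mono hK)
    exact Subtype.ext (le_antisymm (key μ ν h) (key ν μ (by rwa [hsymm])))
  · rintro rfl
    exact wasserstein_self hd.measurable_dist (fun x => (hd.dist.eq_zero_iff x x).2 rfl) _

end Polish

/-! ### The relative entropy and its behaviour at midpoints -/

section Entropy

open InformationTheory ProbabilityTheory

variable {X : Type*} [MeasurableSpace X] {m : Measure X} {V : X → ℝ}

/-- The negative part of `ρ log ρ` is dominated by `exp (-V²) + ρ V²`. -/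
theorem neg_mul_log_le (r v : ℝ) (hr : 0 ≤ r) :
    -(r * Real.log r) ≤ Real.exp (-v ^ 2) + r * v ^ 2 := by
  rcases hr.eq_or_lt with rfl | hr
  · simpa using (Real.exp_pos _).le
  have h := Real.one_sub_inv_le_log_of_pos (mul_pos hr (Real.exp_pos (v ^ 2)))
  rw [Real.log_mul hr.ne' (Real.exp_pos _).ne', Real.log_exp, mul_inv, ← Real.exp_neg] at h
  have h2 := mul_le_mul_of_nonneg_left h hr.le
  rw [mul_sub, ← mul_assoc, mul_inv_cancel₀ hr.ne'] at h2
  nlinarith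

theorem lintegral_neg_mul_log_lt_top [SigmaFinite m] {d : X → X → ℝ≥0∞}
    (hV : IsReferenceWeight d m V) {μ : ProbabilityMeasure X} (hac : (μ : Measure X) ≪ m)
    (hμV : ∫⁻ x, ENNReal.ofReal (V x ^ 2) ∂(μ : Measure X) < ⊤) :
    ∫⁻ x, ENNReal.ofReal (-(((μ : Measure X).rnDeriv m x).toReal *
      Real.log ((μ : Measure X).rnDeriv m x).toReal)) ∂m < ⊤ := by
  have hVm := hV.measurable
  calc _ ≤ ∫⁻ x, (ENNReal.ofReal (Real.exp (-(V x) ^ 2)) +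
        (μ : Measure X).rnDeriv m x * ENNReal.ofReal (V x ^ 2)) ∂m := by
        refine lintegral_mono_ae ?_
        filter_upwards [(μ : Measure X).rnDeriv_lt_top m] with x hx
        refine (ENNReal.ofReal_le_ofReal (neg_mul_log_le _ (V x) ENNReal.toReal_nonneg)).trans ?_
        rw [ENNReal.ofReal_add (Real.exp_pos _).le
          (mul_nonneg ENNReal.toReal_nonneg (sq_nonneg _)),
          ENNReal.ofReal_mul ENNReal.toReal_nonneg, ENNReal.ofReal_toReal hx.ne]
    _ = ∫⁻ x, ENNReal.ofReal (Real.exp (-(V x) ^ 2)) ∂m +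
        ∫⁻ x, ENNReal.ofReal (V x ^ 2) ∂(μ : Measure X) := by
        rw [lintegral_add_left (by fun_prop), lintegral_rnDeriv_mul hac (by fun_prop)]
    _ < ⊤ := ENNReal.add_lt_top.2 ⟨hV.integral_le.trans_lt ENNReal.one_lt_top, hμV⟩

theorem EReal.coe_ennreal_sub_coe_ennreal {a b : ℝ≥0∞} (hb : b ≠ ⊤) :
    ((a : EReal) - (b : EReal) ≠ ⊤ ↔ a ≠ ⊤) ∧
      (a ≠ ⊤ → (a : EReal) - (b : EReal) = ((a.toReal - b.toReal : ℝ) : EReal)) := by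
  lift b to ℝ≥0 using hb
  induction a with
  | top => simp
  | coe a =>
    have : ((a : ℝ≥0∞) : EReal) - ((b : ℝ≥0∞) : EReal) = ((a - b : ℝ) : EReal) := rfl
    simp [this, -EReal.coe_sub]

/-- On its effective domain, the relative entropy is `∫ log ρ dμ`, and this domain consists of the
`μ = ρ m` with `∫ V² dμ < ∞` and `log ρ` integrable for `μ`. -/
theorem relEntropy_cases [SigmaFinite m] {d : X → X → ℝ≥0∞} (hV : IsReferenceWeight d m V)
    (μ : ProbabilityMeasure X) :
    ((μ : Measure X) ≪ m ∧ ∫⁻ x, ENNReal.ofReal (V x ^ 2) ∂(μ : Measure X) < ⊤ ∧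
      Integrable (llr μ m) (μ : Measure X) ∧
        relEntropy m V μ = ((∫ x, llr μ m x ∂(μ : Measure X) : ℝ) : EReal)) ∨
    (¬ ((μ : Measure X) ≪ m ∧ ∫⁻ x, ENNReal.ofReal (V x ^ 2) ∂(μ : Measure X) < ⊤ ∧
      Integrable (llr μ m) (μ : Measure X)) ∧ relEntropy m V μ = ⊤) := by
  by_cases h : (μ : Measure X) ≪ m ∧ ∫⁻ x, ENNReal.ofReal (V x ^ 2) ∂(μ : Measure X) < ⊤
  swap
  · exact Or.inr ⟨fun h' => h ⟨h'.1, h'.2.1⟩, by simp only [relEntropy, if_neg h]⟩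
  have hneg := lintegral_neg_mul_log_lt_top hV h.1 h.2
  set ρ : X → ℝ := fun x => ((μ : Measure X).rnDeriv m x).toReal with hρ
  have hρm : Measurable ρ := (Measure.measurable_rnDeriv _ _).ennreal_toReal
  have hint : Integrable (llr μ m) (μ : Measure X) ↔
      Integrable (fun x => ρ x * Real.log (ρ x)) m :=
    (integrable_rnDeriv_smul_iff h.1).symm
  have hval : ∫ x, llr μ m x ∂(μ : Measure X) = ∫ x, ρ x * Real.log (ρ x) ∂m :=
    (integral_rnDeriv_smul h.1).symm
  have hm : Measurable fun x => ρ x * Real.log (ρ x) := by fun_prop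
  have hE : relEntropy m V μ =
      ((∫⁻ x, ENNReal.ofReal (ρ x * Real.log (ρ x)) ∂m : ℝ≥0∞) : EReal) -
        ((∫⁻ x, ENNReal.ofReal (-(ρ x * Real.log (ρ x))) ∂m : ℝ≥0∞) : EReal) := by
    simp only [relEntropy, if_pos h, hρ]
  obtain ⟨h1, h2⟩ := EReal.coe_ennreal_sub_coe_ennreal
    (a := ∫⁻ x, ENNReal.ofReal (ρ x * Real.log (ρ x)) ∂m) hneg.ne
  by_cases hi : ∫⁻ x, ENNReal.ofReal (ρ x * Real.log (ρ x)) ∂m = ⊤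
  · refine Or.inr ⟨fun h' => ?_, ?_⟩
    · have := (hint.1 h'.2.2).lintegral_lt_top
      exact this.ne hi
    · rw [hE]
      exact not_not.1 fun h' => h1.1 h' hi
  · have hI : Integrable (fun x => ρ x * Real.log (ρ x)) m := by
      refine ⟨hm.aestronglyMeasurable, ?_⟩
      rw [hasFiniteIntegral_iff_norm]
      calc _ = ∫⁻ x, (ENNReal.ofReal (ρ x * Real.log (ρ x)) +
            ENNReal.ofReal (-(ρ x * Real.log (ρ x)))) ∂m := by
            refine lintegral_congr fun x => ?_
            rcases le_total 0 (ρ x * Real.log (ρ x)) with h0 | h0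
            · rw [Real.norm_of_nonneg h0, ENNReal.ofReal_of_nonpos (neg_nonpos.2 h0), add_zero]
            · rw [Real.norm_of_nonpos h0, ENNReal.ofReal_of_nonpos h0, zero_add]
        _ < ⊤ := by
            rw [lintegral_add_left (by fun_prop)]
            exact ENNReal.add_lt_top.2 ⟨lt_top_iff_ne_top.2 hi, hneg⟩
    refine Or.inl ⟨h.1, h.2, hint.2 hI, ?_⟩
    rw [hE, h2 hi, hval, integral_eq_lintegral_pos_part_sub_lintegral_neg_part hI]

theorem mem_effectiveDomain_relEntropy_iff [SigmaFinite m] {d : X → X → ℝ≥0∞}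
    (hV : IsReferenceWeight d m V) {μ : ProbabilityMeasure X} :
    μ ∈ effectiveDomain (relEntropy m V) ↔ (μ : Measure X) ≪ m ∧
      ∫⁻ x, ENNReal.ofReal (V x ^ 2) ∂(μ : Measure X) < ⊤ ∧
        Integrable (llr μ m) (μ : Measure X) := by
  rcases relEntropy_cases hV μ with ⟨h1, h2, h3, h4⟩ | ⟨h1, h2⟩
  · simp [effectiveDomain, h4, h1, h2, h3]
  · simp only [h1, iff_false]
    simp [effectiveDomain, h2]

theorem relEntropy_eq_integral_llr [SigmaFinite m] {d : X → X → ℝ≥0∞}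
    (hV : IsReferenceWeight d m V) {μ : ProbabilityMeasure X}
    (h : μ ∈ effectiveDomain (relEntropy m V)) :
    relEntropy m V μ = ((∫ x, llr μ m x ∂(μ : Measure X) : ℝ) : EReal) := by
  rcases relEntropy_cases hV μ with ⟨_, _, _, h4⟩ | ⟨_, h2⟩
  · exact h4
  · exact absurd h2 h.2

theorem relEntropy_eq_top [SigmaFinite m] {d : X → X → ℝ≥0∞}
    (hV : IsReferenceWeight d m V) {μ : ProbabilityMeasure X}
    (h : μ ∉ effectiveDomain (relEntropy m V)) : relEntropy m V μ = ⊤ := by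
  rcases relEntropy_cases hV μ with ⟨h1, h2, h3, _⟩ | ⟨_, h2⟩
  · exact absurd ((mem_effectiveDomain_relEntropy_iff hV).2 ⟨h1, h2, h3⟩) h
  · exact h2

theorem probMidpoint_comm (μ ν : ProbabilityMeasure X) :
    probMidpoint μ ν = probMidpoint ν μ := by
  refine Subtype.ext ?_
  change (probMidpoint μ ν : Measure X) = probMidpoint ν μ
  rw [coe_probMidpoint, coe_probMidpoint, add_comm]

theorem two_smul_probMidpoint (μ ν : ProbabilityMeasure X) :
    (2 : ℝ≥0∞) • (probMidpoint μ ν : Measure X) = (μ : Measure X) + (ν : Measure X) := by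
  rw [coe_probMidpoint, smul_smul, ENNReal.mul_inv_cancel two_ne_zero ENNReal.ofNat_ne_top,
    one_smul]

theorem le_two_smul_probMidpoint (μ ν : ProbabilityMeasure X) :
    (μ : Measure X) ≤ (2 : ℝ≥0∞) • (probMidpoint μ ν : Measure X) := by
  rw [two_smul_probMidpoint]
  exact Measure.le_add_right le_rfl

theorem absolutelyContinuous_probMidpoint (μ ν : ProbabilityMeasure X) :
    (μ : Measure X) ≪ (probMidpoint μ ν : Measure X) :=
  (Measure.absolutelyContinuous_of_le (le_two_smul_probMidpoint μ ν)).trans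
    Measure.smul_absolutelyContinuous

/-- A measure has finite divergence from any midpoint it belongs to, since its density is at
most `2`. -/
theorem klDiv_probMidpoint_ne_top (μ ν : ProbabilityMeasure X) :
    klDiv (μ : Measure X) (probMidpoint μ ν : Measure X) ≠ ⊤ := by
  have hac := absolutelyContinuous_probMidpoint μ ν
  have hle : (μ : Measure X).rnDeriv (probMidpoint μ ν : Measure X)
      ≤ᵐ[(probMidpoint μ ν : Measure X)] fun _ => 2 := by
    refine ae_le_of_forall_setLIntegral_le_of_sigmaFinite (Measure.measurable_rnDeriv _ _)
      fun s _ _ => (Measure.setLIntegral_rnDeriv_le s).trans ?_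
    rw [setLIntegral_const]
    exact le_two_smul_probMidpoint μ ν s
  obtain ⟨C, hC⟩ := (isCompact_Icc (a := (0 : ℝ)) (b := 2)).exists_bound_of_continuousOn
    continuous_klFun.continuousOn
  rw [klDiv_eq_lintegral_klFun_of_ac hac]
  refine ne_top_of_le_ne_top (b := ENNReal.ofReal C) ENNReal.ofReal_ne_top ?_
  calc _ ≤ ∫⁻ _, ENNReal.ofReal C ∂(probMidpoint μ ν : Measure X) := by
        refine lintegral_mono_ae ?_
        filter_upwards [hle] with x hx
        refine ENNReal.ofReal_le_ofReal ((le_abs_self _).trans (hC _ ⟨ENNReal.toReal_nonneg, ?_⟩))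
        simpa using ENNReal.toReal_mono ENNReal.ofNat_ne_top hx
    _ = _ := by simp

theorem llr_chain [SigmaFinite m] {μ σ : Measure X} [SigmaFinite μ] [SigmaFinite σ]
    (h₁ : μ ≪ σ) (h₂ : σ ≪ m) : llr μ m =ᵐ[μ] fun x => llr μ σ x + llr σ m x := by
  have hpos : ∀ {μ ν : Measure X} [SigmaFinite μ] [SigmaFinite ν], μ ≪ ν →
      ∀ᵐ x ∂μ, 0 < (μ.rnDeriv ν x).toReal := fun {μ ν} _ _ h => by
    filter_upwards [Measure.rnDeriv_pos h, h.ae_le (μ.rnDeriv_lt_top ν)] with x h1 h2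
    exact ENNReal.toReal_pos h1.ne' h2.ne
  filter_upwards [(h₁.trans h₂).ae_le (Measure.rnDeriv_mul_rnDeriv h₁ (κ := m)), hpos h₁,
    h₁.ae_le (hpos h₂)] with x hx h3 h4
  rw [llr, llr, llr, ← hx, Pi.mul_apply, ENNReal.toReal_mul, Real.log_mul h3.ne' h4.ne']

/-- By the chain rule, `log (dσ/dm) = log (dμ/dm) - log (dμ/dσ)` for `σ = (μ + ν) / 2`, where the
last term is `μ`-integrable; the same holds for `ν`. -/
theorem probMidpoint_mem_iff [SigmaFinite m] {d : X → X → ℝ≥0∞} (hV : IsReferenceWeight d m V)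
    {μ ν : ProbabilityMeasure X} :
    probMidpoint μ ν ∈ effectiveDomain (relEntropy m V) ↔
      μ ∈ effectiveDomain (relEntropy m V) ∧ ν ∈ effectiveDomain (relEntropy m V) := by
  have hμ := absolutelyContinuous_probMidpoint μ ν
  have hν : (ν : Measure X) ≪ (probMidpoint μ ν : Measure X) := by
    rw [probMidpoint_comm]; exact absolutelyContinuous_probMidpoint ν μ
  have kμ := (klDiv_ne_top_iff.1 (klDiv_probMidpoint_ne_top μ ν)).2
  have kν : Integrable (llr ν (probMidpoint μ ν : Measure X)) (ν : Measure X) := by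
    rw [probMidpoint_comm]; exact (klDiv_ne_top_iff.1 (klDiv_probMidpoint_ne_top ν μ)).2
  have hInt : ∀ f : X → ℝ, Integrable f (probMidpoint μ ν : Measure X) ↔
      Integrable f (μ : Measure X) ∧ Integrable f (ν : Measure X) := fun f => by
    rw [coe_probMidpoint, integrable_smul_measure (by simp) (by simp), integrable_add_measure]
  have hac : (probMidpoint μ ν : Measure X) ≪ m ↔ (μ : Measure X) ≪ m ∧ (ν : Measure X) ≪ m := by
    refine ⟨fun h => ⟨hμ.trans h, hν.trans h⟩, fun h => ?_⟩
    rw [coe_probMidpoint]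
    exact Measure.smul_absolutelyContinuous.trans (h.1.add_left h.2)
  simp only [mem_effectiveDomain_relEntropy_iff hV]
  rw [hac, hInt, coe_probMidpoint, lintegral_smul_measure, lintegral_add_measure]
  have hfin : ∀ a b : ℝ≥0∞, 2⁻¹ * (a + b) < ⊤ ↔ a < ⊤ ∧ b < ⊤ := fun a b => by
    rw [← ENNReal.add_lt_top]
    refine ⟨fun h => ?_, fun h => ENNReal.mul_lt_top (by simp) h⟩
    exact lt_top_iff_ne_top.2 fun h' => by simp [h', ENNReal.mul_top] at h
  rw [← coe_probMidpoint, smul_eq_mul, hfin]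
  have hchain : ∀ h : (μ : Measure X) ≪ m ∧ (ν : Measure X) ≪ m,
      (Integrable (llr (probMidpoint μ ν : Measure X) m) (μ : Measure X) ↔
        Integrable (llr μ m) (μ : Measure X)) ∧
      (Integrable (llr (probMidpoint μ ν : Measure X) m) (ν : Measure X) ↔
        Integrable (llr ν m) (ν : Measure X)) := fun h => by
    rw [integrable_congr (llr_chain hμ (hac.2 h)), integrable_congr (llr_chain hν (hac.2 h))]
    exact ⟨(integrable_add_iff_integrable_right kμ).symm,
      (integrable_add_iff_integrable_right kν).symm⟩
  constructor
  · rintro ⟨h1, h2, h3⟩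
    have h4 := hchain h1
    simp_all
  · rintro ⟨h1, h2⟩
    have h4 := hchain ⟨h1.1, h2.1⟩
    simp_all

/-- The compensation identity: the entropy gap at a midpoint is the Jensen–Shannon divergence. -/
theorem integral_llr_add_integral_llr [SigmaFinite m] {d : X → X → ℝ≥0∞}
    (hV : IsReferenceWeight d m V)
    {μ ν : ProbabilityMeasure X} (hμ : μ ∈ effectiveDomain (relEntropy m V))
    (hν : ν ∈ effectiveDomain (relEntropy m V)) :
    ∫ x, llr μ m x ∂(μ : Measure X) + ∫ x, llr ν m x ∂(ν : Measure X) =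
      2 * ∫ x, llr (probMidpoint μ ν : Measure X) m x ∂(probMidpoint μ ν : Measure X) +
      ((klDiv (μ : Measure X) (probMidpoint μ ν : Measure X)).toReal +
        (klDiv (ν : Measure X) (probMidpoint μ ν : Measure X)).toReal) := by
  have hσ := (mem_effectiveDomain_relEntropy_iff hV).1 ((probMidpoint_mem_iff hV).2 ⟨hμ, hν⟩)
  have aμ := absolutelyContinuous_probMidpoint μ ν
  have aν : (ν : Measure X) ≪ (probMidpoint μ ν : Measure X) := by
    rw [probMidpoint_comm]; exact absolutelyContinuous_probMidpoint ν μ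
  have kμ := (klDiv_ne_top_iff.1 (klDiv_probMidpoint_ne_top μ ν)).2
  have kν : Integrable (llr ν (probMidpoint μ ν : Measure X)) (ν : Measure X) := by
    rw [probMidpoint_comm]; exact (klDiv_ne_top_iff.1 (klDiv_probMidpoint_ne_top ν μ)).2
  have hi := hσ.2.2
  have hsplit : 2 * ∫ x, llr (probMidpoint μ ν : Measure X) m x ∂(probMidpoint μ ν : Measure X) =
      ∫ x, llr (probMidpoint μ ν : Measure X) m x ∂(μ : Measure X) +
      ∫ x, llr (probMidpoint μ ν : Measure X) m x ∂(ν : Measure X) := by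
    have hi' := hi
    generalize llr (probMidpoint μ ν : Measure X) m = f at hi' ⊢
    rw [coe_probMidpoint, integrable_smul_measure (by simp) (by simp),
      integrable_add_measure] at hi'
    rw [coe_probMidpoint, integral_smul_measure, integral_add_measure hi'.1 hi'.2]
    simp
  have hi' := hi
  generalize hf : llr (probMidpoint μ ν : Measure X) m = f at hi' hsplit
  rw [coe_probMidpoint, integrable_smul_measure (by simp) (by simp),
      integrable_add_measure] at hi'
  subst hf
  rw [integral_congr_ae (llr_chain aμ hσ.1), integral_congr_ae (llr_chain aν hσ.1),
    integral_add kμ hi'.1, integral_add kν hi'.2, hsplit,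
    toReal_klDiv_of_measure_eq aμ (by simp), toReal_klDiv_of_measure_eq aν (by simp)]
  ring

end Entropy

/-! ### Convexity of the squared descending slope -/

theorem ENNReal.two_mul_mul_le (x y : ℝ≥0∞) : 2 * (x * y) ≤ x ^ 2 + y ^ 2 := by
  wlog h : x ≤ y generalizing x y
  · rw [mul_comm x, add_comm]
    exact this y x (le_of_not_ge h)
  obtain ⟨c, rfl⟩ := exists_add_of_le h
  calc 2 * (x * (x + c)) ≤ 2 * (x * (x + c)) + c ^ 2 := le_self_add
    _ = x ^ 2 + (x + c) ^ 2 := by ring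

theorem ENNReal.mul_add_mul_sq_le (a b x y : ℝ≥0∞) :
    (a * x + b * y) ^ 2 ≤ (a ^ 2 + b ^ 2) * (x ^ 2 + y ^ 2) := by
  calc (a * x + b * y) ^ 2 = a ^ 2 * x ^ 2 + b ^ 2 * y ^ 2 + 2 * ((a * y) * (b * x)) := by ring
    _ ≤ a ^ 2 * x ^ 2 + b ^ 2 * y ^ 2 + ((a * y) ^ 2 + (b * x) ^ 2) := by
      gcongr; exact ENNReal.two_mul_mul_le _ _
    _ = (a ^ 2 + b ^ 2) * (x ^ 2 + y ^ 2) := by ring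

theorem ENNReal.two_mul_half_sq_lt {R : ℝ≥0∞} (h0 : 0 < R) (htop : R ≠ ⊤) :
    2 * (R / 2) ^ 2 < R ^ 2 := by
  lift R to ℝ≥0 using htop
  have hR : (0 : ℝ) < R := by exact_mod_cast h0
  have h : 2 * (R / 2) ^ 2 < R ^ 2 := by
    rw [← NNReal.coe_lt_coe]
    push_cast
    nlinarith
  rw [← ENNReal.coe_ofNat, ← ENNReal.coe_div two_ne_zero]
  exact_mod_cast h

/-- Near `x`, drops of `f` are at most `a` times the distance, for `a` above the slope. Points at
distance zero, which the slope ignores, are harmless only since `dY` separates points. -/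
theorem exists_le_mul_of_descendingSlope_lt {Y : Type*} {dY : Y → Y → ℝ≥0∞} {f : Y → EReal}
    (hdY : ∀ x y, dY x y = 0 → x = y) {x : Y} {a : ℝ≥0∞} (h : descendingSlope dY f x < a) :
    x ∈ effectiveDomain f ∧
      ∃ r, 0 < r ∧ ∀ y, dY y x < r → (f x - f y).toENNReal ≤ a * dY y x := by
  have hx : x ∈ effectiveDomain f := by
    by_contra hx
    rw [descendingSlope, if_neg hx] at h
    exact not_top_lt h
  refine ⟨hx, ?_⟩
  rw [descendingSlope, if_pos hx] at h
  simp only [iInf_lt_iff] at h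
  obtain ⟨r, hr, h⟩ := h
  refine ⟨r, hr, fun y hy => ?_⟩
  rcases eq_or_ne (dY y x) 0 with h0 | h0
  · rw [hdY _ _ h0, EReal.sub_self hx.2 hx.1]
    simp
  · have h1 := (le_iSup₂ (f := fun (y : Y) (_ : 0 < dY y x ∧ dY y x < r) =>
      (f x - f y).toENNReal / dY y x) y ⟨pos_iff_ne_zero.2 h0, hy⟩).trans h.le
    exact (ENNReal.div_le_iff h0 (hy.trans_le le_top).ne).1 h1

section Slope

open InformationTheory ProbabilityTheory

variable {X : Type*} [MeasurableSpace X] {d : X → X → ℝ≥0∞}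

/-- A plan `γ` starting from a midpoint `(α + β) / 2` splits into plans starting from `α` and `β`:
move both measures by the disintegration of `γ`. The end point splits accordingly, and by the data
processing inequality this motion does not increase the divergences from the midpoint. -/
theorem exists_split_plan [StandardBorelSpace X] {α β ν : ProbabilityMeasure X}
    {γ : Measure (X × X)}
    (h₁ : γ.fst = (probMidpoint α β : Measure X)) (h₂ : γ.snd = (ν : Measure X)) :
    ∃ α' β' : ProbabilityMeasure X, probMidpoint α' β' = ν ∧
      klDiv (α' : Measure X) (ν : Measure X) ≤
        klDiv (α : Measure X) (probMidpoint α β : Measure X) ∧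
      klDiv (β' : Measure X) (ν : Measure X) ≤
        klDiv (β : Measure X) (probMidpoint α β : Measure X) ∧
      wasserstein d α α' ^ 2 + wasserstein d β β' ^ 2 ≤ 2 * ∫⁻ p, d p.1 p.2 ^ 2 ∂γ := by
  have : Nonempty X := α.nonempty
  have := isProbabilityMeasure_of_fst h₁
  let κ := γ.condKernel
  have hγ : (probMidpoint α β : Measure X).compProd κ = γ := by
    rw [← h₁]; exact γ.disintegrate _
  let move : ProbabilityMeasure X → ProbabilityMeasure X := fun α =>
    ⟨κ ∘ₘ (α : Measure X), inferInstance⟩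
  have hmove : ∀ α : ProbabilityMeasure X, (move α : Measure X) = κ ∘ₘ (α : Measure X) :=
    fun _ => rfl
  have hν : (ν : Measure X) = κ ∘ₘ (probMidpoint α β : Measure X) := by
    rw [← Measure.snd_compProd, hγ, h₂]
  have hsum : (α : Measure X).compProd κ + (β : Measure X).compProd κ = (2 : ℝ≥0∞) • γ := by
    rw [← Measure.compProd_add_left, ← two_smul_probMidpoint, Measure.compProd_smul_left, hγ]
  refine ⟨move α, move β, Subtype.ext ?_, ?_, ?_, ?_⟩
  · change (probMidpoint (move α) (move β) : Measure X) = ν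
    rw [coe_probMidpoint, hmove, hmove, hν, coe_probMidpoint, Measure.comp_smul,
      Measure.comp_add]
  · rw [hν, hmove]; exact klDiv_comp_right_le _ _ _
  · rw [hν, hmove]; exact klDiv_comp_right_le _ _ _
  · have hW : ∀ α : ProbabilityMeasure X, wasserstein d α (move α) ^ 2 ≤
        ∫⁻ p, d p.1 p.2 ^ 2 ∂((α : Measure X).compProd κ) := fun α =>
      wasserstein_sq_le (Measure.fst_compProd _ _) (Measure.snd_compProd _ _)
    refine (add_le_add (hW α) (hW β)).trans_eq ?_
    rw [← lintegral_add_measure, hsum, lintegral_smul_measure, smul_eq_mul]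

variable {m : Measure X} {V : X → ℝ}

theorem toENNReal_relEntropy_sub [SigmaFinite m] (hV : IsReferenceWeight d m V)
    {μ ν : ProbabilityMeasure X} (hμ : μ ∈ effectiveDomain (relEntropy m V))
    (hν : ν ∈ effectiveDomain (relEntropy m V)) :
    (relEntropy m V μ - relEntropy m V ν).toENNReal = ENNReal.ofReal
      (∫ x, llr μ m x ∂(μ : Measure X) - ∫ x, llr ν m x ∂(ν : Measure X)) := by
  rw [relEntropy_eq_integral_llr hV hμ, relEntropy_eq_integral_llr hV hν, ← EReal.coe_sub,
    EReal.toENNReal_of_ne_top (EReal.coe_ne_top _), EReal.toReal_coe]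

/-- The entropy drop along a plan starting from a midpoint is at most the average of the entropy
drops along the two plans into which it splits. -/
theorem exists_split_entropy_drop [StandardBorelSpace X] [SigmaFinite m]
    (hV : IsReferenceWeight d m V)
    {α β ν : ProbabilityMeasure X} (hα : α ∈ effectiveDomain (relEntropy m V))
    (hβ : β ∈ effectiveDomain (relEntropy m V)) {γ : Measure (X × X)}
    (h₁ : γ.fst = (probMidpoint α β : Measure X)) (h₂ : γ.snd = (ν : Measure X)) :
    ∃ α' β' : ProbabilityMeasure X,
      wasserstein d α α' ^ 2 + wasserstein d β β' ^ 2 ≤ 2 * ∫⁻ p, d p.1 p.2 ^ 2 ∂γ ∧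
      (relEntropy m V (probMidpoint α β) - relEntropy m V ν).toENNReal ≤
        2⁻¹ * ((relEntropy m V α - relEntropy m V α').toENNReal +
          (relEntropy m V β - relEntropy m V β').toENNReal) := by
  obtain ⟨α', β', hν, hk₁, hk₂, hW⟩ := exists_split_plan (d := d) h₁ h₂
  refine ⟨α', β', hW, ?_⟩
  by_cases hνD : ν ∈ effectiveDomain (relEntropy m V)
  swap
  · simp [relEntropy_eq_top hV hνD]
  obtain ⟨hα', hβ'⟩ := (probMidpoint_mem_iff hV).1 (hν ▸ hνD)
  rw [toENNReal_relEntropy_sub hV ((probMidpoint_mem_iff hV).2 ⟨hα, hβ⟩) hνD,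
    toENNReal_relEntropy_sub hV hα hα', toENNReal_relEntropy_sub hV hβ hβ']
  have e₁ := integral_llr_add_integral_llr hV hα hβ
  have e₂ := integral_llr_add_integral_llr hV hα' hβ'
  rw [hν] at e₂
  have k₁ := ENNReal.toReal_mono (klDiv_probMidpoint_ne_top α β) hk₁
  have k₂ := ENNReal.toReal_mono
    (by rw [probMidpoint_comm]; exact klDiv_probMidpoint_ne_top β α) hk₂
  have h2 : (2⁻¹ : ℝ≥0∞) = ENNReal.ofReal 2⁻¹ := by
    rw [ENNReal.ofReal_inv_of_pos two_pos]; simp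
  calc _ ≤ ENNReal.ofReal (2⁻¹ * ((∫ x, llr α m x ∂(α : Measure X) -
        ∫ x, llr α' m x ∂(α' : Measure X)) + (∫ x, llr β m x ∂(β : Measure X) -
        ∫ x, llr β' m x ∂(β' : Measure X)))) := ENNReal.ofReal_le_ofReal (by linarith)
    _ ≤ _ := by
      rw [ENNReal.ofReal_mul (by norm_num), h2]
      gcongr
      exact ENNReal.ofReal_add_le

end Slope

/-- The squared descending slope of the entropy is convex under averaging. Along a plan from the
midpoint with cost `c²`, which splits into plans with costs `A²` and `B²`, `A² + B² = 2 c²`, the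
entropy drops by at most `(a A + b B) / 2 ≤ ((a² + b²) / 2)^(1/2) c` when `a` and `b` exceed the
slopes at the two measures. -/
theorem descendingSlope_probMidpoint_sq_le {X : Type*} [TopologicalSpace X] [MeasurableSpace X]
    [BorelSpace X] {d : X → X → ℝ≥0∞} (hd : IsPolishExtended d)
    {m : Measure X} [SigmaFinite m] {V : X → ℝ} (hV : IsReferenceWeight d m V)
    {μ : ProbabilityMeasure X} (α β : WassersteinClass d μ) :
    descendingSlope (wasserstein d) (relEntropy m V) (probMidpoint α.1 β.1) ^ 2 ≤
      2⁻¹ * (descendingSlope (fun ν₁ ν₂ : WassersteinClass d μ => wasserstein d ν₁.1 ν₂.1)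
          (fun ν => relEntropy m V ν.1) α ^ 2 +
        descendingSlope (fun ν₁ ν₂ : WassersteinClass d μ => wasserstein d ν₁.1 ν₂.1)
          (fun ν => relEntropy m V ν.1) β ^ 2) := by
  have := hd.polish
  have hW := wasserstein_isExtendedDist hd
  refine ENNReal.le_inv_two_mul_sq_add_sq fun a b ha hb => ?_
  have hW0 : ∀ x y : WassersteinClass d μ, wasserstein d x.1 y.1 = 0 → x = y := fun x y h =>
    Subtype.ext ((hW.eq_zero_iff _ _).1 h)
  obtain ⟨hαD, ra, hra, hda⟩ := exists_le_mul_of_descendingSlope_lt hW0 ha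
  obtain ⟨hβD, rb, hrb, hdb⟩ := exists_le_mul_of_descendingSlope_lt hW0 hb
  have drop : ∀ (α : WassersteinClass d μ) (a r : ℝ≥0∞), (∀ y : WassersteinClass d μ,
      wasserstein d y.1 α.1 < r →
        (relEntropy m V α.1 - relEntropy m V y.1).toENNReal ≤ a * wasserstein d y.1 α.1) →
      ∀ ν : ProbabilityMeasure X, wasserstein d α.1 ν < r →
        (relEntropy m V α.1 - relEntropy m V ν).toENNReal ≤ a * wasserstein d α.1 ν := by
    intro α a r h ν hν
    have hmem : wasserstein d μ ν < ⊤ := (hW.triangle _ _ α.1).trans_lt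
      (ENNReal.add_lt_top.2 ⟨α.2, hν.trans_le le_top⟩)
    rw [hW.symm] at hν ⊢
    exact h ⟨ν, hmem⟩ hν
  -- plans of cost at most `(R / 2)²` split into plans of cost less than `R²`
  set R : ℝ≥0∞ := min (min ra rb) 1 with hR
  have hR0 : 0 < R := lt_min (lt_min hra hrb) one_pos
  have hRtop : R ≠ ⊤ := ne_top_of_le_ne_top ENNReal.one_ne_top (min_le_right _ _)
  have hRR := ENNReal.two_mul_half_sq_lt hR0 hRtop
  set C : ℝ≥0∞ := 2⁻¹ * (a ^ 2 + b ^ 2) with hC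
  have ha0 : a ≠ 0 := (pos_of_gt ha).ne'
  have hC0 : C ≠ 0 := by simp [hC, ha0]
  have core : ∀ (ν : ProbabilityMeasure X) (u : ℝ≥0∞),
      wasserstein d ν (probMidpoint α.1 β.1) ^ 2 < u → u ≤ (R / 2) ^ 2 →
      (relEntropy m V (probMidpoint α.1 β.1) - relEntropy m V ν).toENNReal ^ 2 ≤ C * u := by
    intro ν u hu huR
    rw [hW.symm] at hu
    obtain ⟨γ, h₁, h₂, h₃⟩ := exists_plan_lt hu
    obtain ⟨α', β', hcost, hent⟩ :=
      exists_split_entropy_drop hV hαD hβD h₁ h₂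
    have hcost' : wasserstein d α.1 α' ^ 2 + wasserstein d β.1 β' ^ 2 ≤ 2 * u :=
      hcost.trans (by gcongr)
    have hlt : wasserstein d α.1 α' ^ 2 + wasserstein d β.1 β' ^ 2 < R ^ 2 :=
      (hcost'.trans (by gcongr)).trans_lt hRR
    have hA : wasserstein d α.1 α' < R := (ENNReal.pow_lt_pow_left_iff two_ne_zero).1
      (le_self_add.trans_lt hlt)
    have hB : wasserstein d β.1 β' < R := (ENNReal.pow_lt_pow_left_iff two_ne_zero).1
      (le_add_self.trans_lt hlt)
    have hA' := drop α a ra hda α' (hA.trans_le ((min_le_left _ _).trans (min_le_left _ _)))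
    have hB' := drop β b rb hdb β' (hB.trans_le ((min_le_left _ _).trans (min_le_right _ _)))
    calc _ ≤ (2⁻¹ * (a * wasserstein d α.1 α' + b * wasserstein d β.1 β')) ^ 2 := by
          gcongr; exact hent.trans (by gcongr)
      _ = 2⁻¹ ^ 2 * (a * wasserstein d α.1 α' + b * wasserstein d β.1 β') ^ 2 := mul_pow _ _ _
      _ ≤ 2⁻¹ ^ 2 * ((a ^ 2 + b ^ 2) * (2 * u)) := by
          gcongr; exact (ENNReal.mul_add_mul_sq_le _ _ _ _).trans (by gcongr)
      _ = (2⁻¹ * 2) * C * u := by rw [hC]; ring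
      _ = C * u := by rw [ENNReal.inv_mul_cancel two_ne_zero ENNReal.ofNat_ne_top, one_mul]
  rw [← ENNReal.sq_rpow_half C]
  refine pow_le_pow_left' ?_ 2
  rw [descendingSlope, if_pos ((probMidpoint_mem_iff hV).2 ⟨hαD, hβD⟩)]
  refine iInf₂_le_of_le (R / 2) (ENNReal.half_pos hR0.ne') (iSup₂_le fun ν hν => ?_)
  have hW2 : wasserstein d ν (probMidpoint α.1 β.1) ≠ ⊤ := (hν.2.trans_le le_top).ne
  refine ENNReal.div_le_of_le_mul (ENNReal.le_of_sq_le_sq ?_)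
  rw [mul_pow, ENNReal.sq_rpow_half]
  rcases eq_or_ne C ⊤ with hCt | hCt
  · rw [hCt, ENNReal.top_mul (pow_ne_zero 2 hν.1.ne')]
    exact le_top
  -- let the cost of the plans decrease to the squared distance
  by_contra hlt
  rw [not_le, mul_comm, ← ENNReal.lt_div_iff_mul_lt (Or.inl hC0) (Or.inl hCt)] at hlt
  obtain ⟨u, hu, hu'⟩ := exists_between
    (lt_min hlt (ENNReal.pow_lt_pow_left two_ne_zero hν.2))
  refine (core ν u hu (hu'.le.trans (min_le_right _ _))).not_gt ?_
  rw [mul_comm, ← ENNReal.lt_div_iff_mul_lt (Or.inl hC0) (Or.inl hCt)]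
  exact hu'.trans_le (min_le_left _ _)

/-! ### Absolutely continuous curves and metric derivatives -/

section Curves

variable {Y : Type*} {dY : Y → Y → ℝ≥0∞}

theorem IsACCurveOn.comp_mul_left {y : ℝ → Y} {T : ℝ} (hT : 0 < T) (h : IsACCurveOn dY y 0 T) :
    IsACCurveOn dY (fun s => y (T * s)) 0 1 := by
  obtain ⟨g, hg, hd⟩ := h
  refine ⟨fun r => T * g (T * r), ?_, fun s t hs hst ht => ?_⟩
  · have h1 := (intervalIntegrable_iff_integrableOn_Icc_of_le hT.le).2 hg
    have h2 := h1.comp_mul_left (c := T)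
    rw [zero_div, div_self hT.ne'] at h2
    exact ((intervalIntegrable_iff_integrableOn_Icc_of_le zero_le_one).1 h2).const_mul T
  · rw [intervalIntegral.integral_const_mul, intervalIntegral.mul_integral_comp_mul_left]
    exact hd _ _ (mul_nonneg hT.le hs) (by gcongr) (by nlinarith)

theorem metricDerivative_comp_mul_left_le (y : ℝ → Y) {T : ℝ} (hT : 0 < T) (s : ℝ) :
    metricDerivative dY (fun s => y (T * s)) s ≤
      ENNReal.ofReal T * metricDerivative dY y (T * s) := by
  have hlim : Tendsto (fun r => T * r) (𝓝[≠] s) (𝓝[≠] (T * s)) := by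
    refine tendsto_nhdsWithin_of_tendsto_nhds_of_eventually_within _ ?_ ?_
    · exact ((continuous_const_mul T).tendsto s).mono_left nhdsWithin_le_nhds
    · filter_upwards [self_mem_nhdsWithin] with r hr
      exact fun h => hr (mul_left_cancel₀ hT.ne' h)
  calc metricDerivative dY (fun s => y (T * s)) s
      = limsup (fun r => ENNReal.ofReal T *
          (dY (y (T * r)) (y (T * s)) / ENNReal.ofReal |T * r - T * s|)) (𝓝[≠] s) := by
        refine limsup_congr (Eventually.of_forall fun r => ?_)
        rw [← mul_sub, abs_mul, abs_of_pos hT, ENNReal.ofReal_mul hT.le, div_eq_mul_inv,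
          div_eq_mul_inv, ENNReal.mul_inv (Or.inl (by simpa using hT))
          (Or.inl ENNReal.ofReal_ne_top), mul_left_comm, ← mul_assoc (ENNReal.ofReal T),
          ENNReal.mul_inv_cancel (by simpa using hT) ENNReal.ofReal_ne_top, one_mul]
    _ = ENNReal.ofReal T * limsup (fun r =>
          dY (y (T * r)) (y (T * s)) / ENNReal.ofReal |T * r - T * s|) (𝓝[≠] s) :=
        ENNReal.limsup_const_mul_of_ne_top ENNReal.ofReal_ne_top
    _ ≤ _ := by
        gcongr
        exact limsup_le_limsup_of_le (f := map (fun r => T * r) (𝓝[≠] s)) hlim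
          (u := fun r => dY (y r) (y (T * s)) / ENNReal.ofReal |r - T * s|)

theorem metricDerivative_congr {y y' : ℝ → Y} {t : ℝ} (h : y =ᶠ[𝓝 t] y') :
    metricDerivative dY y t = metricDerivative dY y' t := by
  refine limsup_congr ?_
  filter_upwards [nhdsWithin_le_nhds h] with s hs
  rw [hs, h.self_of_nhds]

/-- The metric derivative of a continuous curve is measurable: it is a countable infimum of suprema
of difference quotients `dY (y (t + h)) (y t) / |h|`, which are continuous in `t`. -/
theorem measurable_metricDerivative {Y : Type*} [PseudoEMetricSpace Y] {y : ℝ → Y}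
    (hy : Continuous y) : Measurable (metricDerivative edist y) := by
  obtain ⟨B, hB⟩ := (𝓝[≠] (0 : ℝ)).exists_antitone_basis
  have key : metricDerivative edist y =
      fun t => ⨅ n : ℕ, ⨆ h ∈ B n, edist (y (t + h)) (y t) / ENNReal.ofReal |h| := by
    funext t
    have hmap : 𝓝[≠] t = map (fun h => t + h) (𝓝[≠] 0) := by simp
    rw [metricDerivative, hmap, ← limsup_comp, hB.toHasBasis.limsup_eq_iInf_iSup]
    simp
  rw [key]
  refine Measurable.iInf fun n => LowerSemicontinuous.measurable ?_
  refine lowerSemicontinuous_iSup fun h => lowerSemicontinuous_iSup fun _ => ?_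
  -- the basis sets may contain `0`, where the quotient is `0 / 0 = 0`
  rcases eq_or_ne h 0 with rfl | h0
  · simpa using lowerSemicontinuous_const
  · refine Continuous.lowerSemicontinuous ?_
    have : ENNReal.ofReal |h| ≠ 0 := by simpa using h0
    exact (ENNReal.continuous_div_const _ this).comp
      ((hy.comp (continuous_id.add continuous_const)).edist hy)

theorem IsACCurveOn.aemeasurable_metricDerivative (hd : IsExtendedDist dY) {y : ℝ → Y} {T : ℝ}
    (hT : 0 < T) (h : IsACCurveOn dY y 0 T) :
    AEMeasurable (metricDerivative dY y) (volume.restrict (Ioo 0 T)) := by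
  let _ : PseudoEMetricSpace Y :=
    { edist := dY
      edist_self := fun x => (hd.eq_zero_iff x x).2 rfl
      edist_comm := hd.symm
      edist_triangle := fun x y z => hd.triangle x z y }
  obtain ⟨g, hg, hgd⟩ := h
  -- extend the curve continuously to all times by its end points
  let c : ℝ → ℝ := fun s => projIcc 0 T hT.le s
  have hc : Continuous c := continuous_subtype_val.comp continuous_projIcc
  have hcm : ∀ s, c s ∈ Icc 0 T := fun s => (projIcc 0 T hT.le s).2
  let G : ℝ → ℝ := fun t => ∫ r in (0 : ℝ)..t, g r
  have hG : ContinuousOn G (Icc 0 T) := by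
    have := intervalIntegral.continuousOn_primitive_interval (μ := volume) (f := g) (a := 0)
      (b := T) (by rwa [uIcc_of_le hT.le])
    rwa [uIcc_of_le hT.le] at this
  have hGc : Continuous fun s => G (c s) := hG.comp_continuous hc hcm
  have hint : ∀ a ∈ Icc 0 T, IntervalIntegrable g volume 0 a := fun a ha =>
    (intervalIntegrable_iff_integrableOn_Icc_of_le ha.1).2
      (hg.mono_set (Icc_subset_Icc_right ha.2))
  have hle : ∀ a ∈ Icc 0 T, ∀ b ∈ Icc 0 T, a ≤ b →
      edist (y a) (y b) ≤ ENNReal.ofReal |G a - G b| := by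
    intro a ha b hb hab
    refine (hgd a b ha.1 hab hb.2).trans (ENNReal.ofReal_le_ofReal ?_)
    rw [← intervalIntegral.integral_interval_sub_left (hint b hb) (hint a ha), abs_sub_comm]
    exact le_abs_self _
  have hbound : ∀ s t, edist (y (c s)) (y (c t)) ≤ ENNReal.ofReal |G (c s) - G (c t)| := by
    intro s t
    rcases le_total (c s) (c t) with hst | hst
    · exact hle _ (hcm s) _ (hcm t) hst
    · rw [edist_comm, abs_sub_comm]
      exact hle _ (hcm t) _ (hcm s) hst
  have hcont : Continuous fun s => y (c s) := by
    refine continuous_iff_continuousAt.2 fun t => ?_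
    refine tendsto_iff_edist_tendsto_0.2 (tendsto_of_tendsto_of_tendsto_of_le_of_le
      tendsto_const_nhds ?_ (fun _ => bot_le) (fun s => hbound s t))
    have : Continuous fun s => ENNReal.ofReal |G (c s) - G (c t)| :=
      ENNReal.continuous_ofReal.comp (hGc.sub continuous_const).abs
    simpa using this.tendsto t
  refine (measurable_metricDerivative hcont).aemeasurable.congr ?_
  filter_upwards [ae_restrict_mem measurableSet_Ioo] with t ht
  refine metricDerivative_congr ?_
  filter_upwards [isOpen_Ioo.mem_nhds ht] with s hs
  exact congrArg y (congrArg Subtype.val (projIcc_of_mem hT.le (Ioo_subset_Icc_self hs)))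

theorem setLIntegral_comp_mul_left {T : ℝ} (hT : 0 < T) (f : ℝ → ℝ≥0∞) :
    ∫⁻ s in Ioo 0 1, ENNReal.ofReal T * f (T * s) = ∫⁻ r in Ioo 0 T, f r := by
  have h := lintegral_image_eq_lintegral_abs_deriv_mul (s := Ioo (0 : ℝ) 1) (f := fun s => T * s)
    (f' := fun _ => T) measurableSet_Ioo
    (fun x _ => by simpa using ((hasDerivAt_id x).const_mul T).hasDerivWithinAt)
    (fun a _ b _ hab => mul_left_cancel₀ hT.ne' hab) f
  rw [abs_of_pos hT] at h
  rw [← h]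
  have : (fun s => T * s) '' Ioo (0 : ℝ) 1 = Ioo 0 T := by
    rw [image_mul_left_Ioo hT]; simp
  rw [this]

end Curves

section MidpointCurve

variable {X : Type*} [MeasurableSpace X] {d : X → X → ℝ≥0∞}

theorem IsACCurveOn.probMidpoint {y z : ℝ → ProbabilityMeasure X} {a b : ℝ}
    (hy : IsACCurveOn (wasserstein d) y a b) (hz : IsACCurveOn (wasserstein d) z a b) :
    IsACCurveOn (wasserstein d) (fun t => probMidpoint (y t) (z t)) a b := by
  obtain ⟨g, hg, hgd⟩ := hy
  obtain ⟨g', hg', hgd'⟩ := hz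
  refine ⟨fun r => |g r| + |g' r|, hg.abs.add hg'.abs, fun s t hs hst ht => ?_⟩
  have hsub : ∀ {g : ℝ → ℝ}, IntegrableOn g (Icc a b) → IntervalIntegrable g volume s t :=
    fun hg => (intervalIntegrable_iff_integrableOn_Icc_of_le hst).2
      (hg.mono_set (Icc_subset_Icc hs ht))
  have habs : ∀ {g : ℝ → ℝ} {e : ℝ≥0∞}, e ≤ ENNReal.ofReal (∫ r in s..t, g r) →
      e ≤ ENNReal.ofReal (∫ r in s..t, |g r|) := fun he =>
    he.trans (ENNReal.ofReal_le_ofReal ((le_abs_self _).trans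
      (intervalIntegral.abs_integral_le_integral_abs hst)))
  have hnn : ∀ g : ℝ → ℝ, 0 ≤ ∫ r in s..t, |g r| := fun g =>
    intervalIntegral.integral_nonneg hst fun _ _ => abs_nonneg _
  rw [intervalIntegral.integral_add (hsub hg.abs) (hsub hg'.abs),
    ENNReal.ofReal_add (hnn g) (hnn g')]
  refine le_trans ?_ (add_le_add (habs (hgd s t hs hst ht)) (habs (hgd' s t hs hst ht)))
  refine ENNReal.le_of_sq_le_sq ((wasserstein_probMidpoint_sq_le _ _ _ _).trans ?_)
  calc _ ≤ 1 * (wasserstein d (y s) (y t) ^ 2 + wasserstein d (z s) (z t) ^ 2) := by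
        gcongr; simp
    _ ≤ wasserstein d (y s) (y t) ^ 2 + wasserstein d (z s) (z t) ^ 2 +
        2 * wasserstein d (y s) (y t) * wasserstein d (z s) (z t) := by
        rw [one_mul]; exact le_self_add
    _ = _ := by ring

theorem metricDerivative_probMidpoint_sq_le (y z : ℝ → ProbabilityMeasure X) (t : ℝ) :
    metricDerivative (wasserstein d) (fun t => probMidpoint (y t) (z t)) t ^ 2 ≤
      2⁻¹ * (metricDerivative (wasserstein d) y t ^ 2 +
        metricDerivative (wasserstein d) z t ^ 2) := by
  refine ENNReal.le_inv_two_mul_sq_add_sq fun a b ha hb => ?_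
  set C : ℝ≥0∞ := 2⁻¹ * (a ^ 2 + b ^ 2) with hC
  rw [← ENNReal.sq_rpow_half C]
  refine pow_le_pow_left' (limsup_le_of_le (h := ?_)) 2
  filter_upwards [eventually_lt_of_limsup_lt ha, eventually_lt_of_limsup_lt hb] with s hs hs'
  refine ENNReal.le_of_sq_le_sq ?_
  rw [ENNReal.sq_rpow_half, div_eq_mul_inv, mul_pow]
  calc _ ≤ 2⁻¹ * (wasserstein d (y s) (y t) ^ 2 + wasserstein d (z s) (z t) ^ 2) *
        (ENNReal.ofReal |s - t|)⁻¹ ^ 2 := by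
        gcongr; exact wasserstein_probMidpoint_sq_le _ _ _ _
    _ = 2⁻¹ * ((wasserstein d (y s) (y t) / ENNReal.ofReal |s - t|) ^ 2 +
        (wasserstein d (z s) (z t) / ENNReal.ofReal |s - t|) ^ 2) := by
        rw [div_eq_mul_inv, div_eq_mul_inv]; ring
    _ ≤ C := by rw [hC]; gcongr

end MidpointCurve

/-! ### Uniqueness of the gradient flow -/

section Uniqueness

open InformationTheory

/-- Both terms of the energy dissipation are finite, since the energies are. -/
theorem EReal.toReal_dissipation_identity {e₀ e : ℝ} {a b : ℝ≥0∞}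
    (h : (e₀ : EReal) = e + (a : EReal) + (b : EReal)) :
    a + b ≠ ⊤ ∧ e₀ = e + (a + b).toReal := by
  have ha : a ≠ ⊤ := by
    rintro rfl
    rw [EReal.coe_ennreal_top, EReal.coe_add_top, EReal.top_add_of_ne_bot (by simp)] at h
    exact EReal.coe_ne_top _ h
  have hb : b ≠ ⊤ := by
    rintro rfl
    lift a to ℝ≥0 using ha
    rw [EReal.coe_ennreal_top, EReal.add_top_of_ne_bot
      (by rw [ne_eq, EReal.add_eq_bot_iff]; simp)] at h
    exact EReal.coe_ne_top _ h
  refine ⟨ENNReal.add_ne_top.2 ⟨ha, hb⟩, ?_⟩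
  rw [ENNReal.toReal_add ha hb]
  lift a to ℝ≥0 using ha
  lift b to ℝ≥0 using hb
  have h' : (e₀ : EReal) = ((e + a + b : ℝ) : EReal) := h
  rw [EReal.coe_eq_coe_iff] at h'
  rw [h']
  simp [add_assoc]

variable {X : Type*} [TopologicalSpace X] [MeasurableSpace X] [BorelSpace X] {d : X → X → ℝ≥0∞}
  {m : Measure X} [SigmaFinite m] {V : X → ℝ} {μ : ProbabilityMeasure X}

/-- The midpoint of two gradient flows, which starts from the common initial datum, loses at most
the average of the energies dissipated by the two flows. -/
theorem abs_relEntropy_probMidpoint_sub_le (hd : IsPolishExtended d)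
    (hV : IsReferenceWeight d m V)
    (hslope : IsUpperGradient (wasserstein d) (relEntropy m V)
      (descendingSlope (wasserstein d) (relEntropy m V)))
    {y z : ℝ → WassersteinClass d μ}
    (hy : IsMetricGradientFlow (fun ν₁ ν₂ : WassersteinClass d μ => wasserstein d ν₁.1 ν₂.1)
      (fun ν => relEntropy m V ν.1) y)
    (hz : IsMetricGradientFlow (fun ν₁ ν₂ : WassersteinClass d μ => wasserstein d ν₁.1 ν₂.1)
      (fun ν => relEntropy m V ν.1) z) {T : ℝ} (hT : 0 < T) :
    (relEntropy m V (probMidpoint (y T).1 (z T).1) -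
        relEntropy m V (probMidpoint (y 0).1 (z 0).1)).abs ≤
      2⁻¹ * (
        ((1 / 2 : ℝ≥0∞) * (∫⁻ r in Ioo 0 T, metricDerivative
          (fun ν₁ ν₂ : WassersteinClass d μ => wasserstein d ν₁.1 ν₂.1) y r ^ 2) +
        (1 / 2 : ℝ≥0∞) * ∫⁻ r in Ioo 0 T, descendingSlope
          (fun ν₁ ν₂ : WassersteinClass d μ => wasserstein d ν₁.1 ν₂.1)
          (fun ν => relEntropy m V ν.1) (y r) ^ 2) +
        ((1 / 2 : ℝ≥0∞) * (∫⁻ r in Ioo 0 T, metricDerivative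
          (fun ν₁ ν₂ : WassersteinClass d μ => wasserstein d ν₁.1 ν₂.1) z r ^ 2) +
        (1 / 2 : ℝ≥0∞) * ∫⁻ r in Ioo 0 T, descendingSlope
          (fun ν₁ ν₂ : WassersteinClass d μ => wasserstein d ν₁.1 ν₂.1)
          (fun ν => relEntropy m V ν.1) (z r) ^ 2)) := by
  have hW := wasserstein_isExtendedDist hd
  have hWC : IsExtendedDist (fun ν₁ ν₂ : WassersteinClass d μ => wasserstein d ν₁.1 ν₂.1) :=
    ⟨fun _ _ => (hW.eq_zero_iff _ _).trans Subtype.ext_iff.symm, fun _ _ => hW.symm _ _,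
      fun _ _ _ => hW.triangle _ _ _⟩
  have mA := (hy.absCont T hT).aemeasurable_metricDerivative hWC hT
  have mC := (hz.absCont T hT).aemeasurable_metricDerivative hWC hT
  have mB := hy.slope_measurable.mono_measure
    (Measure.restrict_mono (Ioo_subset_Ioi_self : Ioo 0 T ⊆ Ioi 0) le_rfl)
  set σ : ℝ → ProbabilityMeasure X := fun t => probMidpoint (y t).1 (z t).1 with hσ
  have hmd : ∀ r, metricDerivative (wasserstein d) σ r ^ 2 ≤ 2⁻¹ * (metricDerivative
      (fun ν₁ ν₂ : WassersteinClass d μ => wasserstein d ν₁.1 ν₂.1) y r ^ 2 + metricDerivative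
      (fun ν₁ ν₂ : WassersteinClass d μ => wasserstein d ν₁.1 ν₂.1) z r ^ 2) := fun r =>
    metricDerivative_probMidpoint_sq_le (fun t => (y t).1) (fun t => (z t).1) r
  have hsl : ∀ r, _ := fun r => descendingSlope_probMidpoint_sq_le hd hV (y r) (z r)
  set A := metricDerivative (fun ν₁ ν₂ : WassersteinClass d μ => wasserstein d ν₁.1 ν₂.1) y
  set C := metricDerivative (fun ν₁ ν₂ : WassersteinClass d μ => wasserstein d ν₁.1 ν₂.1) z
  set B := fun r => descendingSlope
    (fun ν₁ ν₂ : WassersteinClass d μ => wasserstein d ν₁.1 ν₂.1)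
    (fun ν => relEntropy m V ν.1) (y r)
  set D := fun r => descendingSlope
    (fun ν₁ ν₂ : WassersteinClass d μ => wasserstein d ν₁.1 ν₂.1)
    (fun ν => relEntropy m V ν.1) (z r)
  have hAC : IsACCurveOn (wasserstein d) (fun s => σ (T * s)) 0 1 :=
    (IsACCurveOn.probMidpoint (y := fun t => (y t).1) (z := fun t => (z t).1)
      (hy.absCont T hT) (hz.absCont T hT)).comp_mul_left hT
  have hdom : ∀ t ∈ Icc (0 : ℝ) 1, σ (T * t) ∈ effectiveDomain (relEntropy m V) := fun t ht =>
    (probMidpoint_mem_iff hV).2 ⟨hy.mem_domain _ (mul_nonneg hT.le ht.1),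
      hz.mem_domain _ (mul_nonneg hT.le ht.1)⟩
  have hug := (hslope _ hAC hdom).2
  simp only [mul_one, mul_zero] at hug
  calc _ ≤ _ := hug
    -- rescale the speed, then apply Young's inequality and the two convexity estimates
    _ ≤ ∫⁻ s in Ioo (0 : ℝ) 1, ENNReal.ofReal T * (2⁻¹ * (2⁻¹ *
          ((A (T * s) ^ 2 + B (T * s) ^ 2) + (C (T * s) ^ 2 + D (T * s) ^ 2)))) := by
        refine lintegral_mono fun s => ?_
        refine (mul_le_mul_right (metricDerivative_comp_mul_left_le σ hT s) _).trans ?_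
        rw [mul_left_comm]
        refine mul_le_mul_right ?_ _
        set p := descendingSlope (wasserstein d) (relEntropy m V) (σ (T * s)) with hp
        set q := metricDerivative (wasserstein d) σ (T * s) with hq
        calc p * q = 2⁻¹ * (2 * (p * q)) := by
              rw [← mul_assoc, ENNReal.inv_mul_cancel two_ne_zero ENNReal.ofNat_ne_top, one_mul]
          _ ≤ 2⁻¹ * (2⁻¹ * (B (T * s) ^ 2 + D (T * s) ^ 2) +
                2⁻¹ * (A (T * s) ^ 2 + C (T * s) ^ 2)) :=
              mul_le_mul_right ((ENNReal.two_mul_mul_le p q).trans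
                (add_le_add (hsl (T * s)) (hmd (T * s)))) _
          _ = _ := by ring
    _ = ∫⁻ r in Ioo 0 T, 2⁻¹ * (2⁻¹ * ((A r ^ 2 + B r ^ 2) + (C r ^ 2 + D r ^ 2))) :=
        setLIntegral_comp_mul_left hT
          fun r => 2⁻¹ * (2⁻¹ * ((A r ^ 2 + B r ^ 2) + (C r ^ 2 + D r ^ 2)))
    _ = _ := by
        have h2 : (2⁻¹ : ℝ≥0∞) ≠ ⊤ := by simp
        change _ = 2⁻¹ * (((1 / 2) * (∫⁻ r in Ioo 0 T, A r ^ 2) +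
          (1 / 2) * ∫⁻ r in Ioo 0 T, B r ^ 2) + ((1 / 2) * (∫⁻ r in Ioo 0 T, C r ^ 2) +
          (1 / 2) * ∫⁻ r in Ioo 0 T, D r ^ 2))
        rw [lintegral_const_mul' _ _ h2, lintegral_const_mul' _ _ h2,
          lintegral_add_left' (f := fun r => A r ^ 2 + B r ^ 2)
            ((mA.pow_const 2).add (mB.pow_const 2)),
          lintegral_add_left' (mA.pow_const 2), lintegral_add_left' (mC.pow_const 2), one_div]
        ring

end Uniqueness

theorem mainTheorem9 {X : Type*} [TopologicalSpace X] [MeasurableSpace X] [BorelSpace X]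
    (d : X → X → ℝ≥0∞) (hd : IsPolishExtended d)
    (m : Measure X) [SigmaFinite m] (V : X → ℝ) (hV : IsReferenceWeight d m V)
    (hslope : IsUpperGradient (wasserstein d) (relEntropy m V)
      (descendingSlope (wasserstein d) (relEntropy m V)))
    (μ : ProbabilityMeasure X) (hμ : μ ∈ effectiveDomain (relEntropy m V))
    (y z : ℝ → WassersteinClass d μ)
    (hy : IsMetricGradientFlow (fun ν₁ ν₂ : WassersteinClass d μ => wasserstein d ν₁.1 ν₂.1)
      (fun ν => relEntropy m V ν.1) y)
    (hy0 : (y 0).1 = μ)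
    (hz : IsMetricGradientFlow (fun ν₁ ν₂ : WassersteinClass d μ => wasserstein d ν₁.1 ν₂.1)
      (fun ν => relEntropy m V ν.1) z)
    (hz0 : (z 0).1 = μ) :
    ∀ t : ℝ, 0 ≤ t → y t = z t := by
  intro T hT0
  rcases hT0.eq_or_lt with rfl | hT
  · exact Subtype.ext (hy0.trans hz0.symm)
  have hyD : (y T).1 ∈ effectiveDomain (relEntropy m V) := hy.mem_domain T hT0
  have hzD : (z T).1 ∈ effectiveDomain (relEntropy m V) := hz.mem_domain T hT0
  have hσD := (probMidpoint_mem_iff hV).2 ⟨hyD, hzD⟩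
  have hloss := abs_relEntropy_probMidpoint_sub_le hd hV hslope hy hz hT
  have ey := hy.energy_eq T hT0
  have ez := hz.energy_eq T hT0
  rw [hy0, relEntropy_eq_integral_llr hV hμ, relEntropy_eq_integral_llr hV hyD] at ey
  rw [hz0, relEntropy_eq_integral_llr hV hμ, relEntropy_eq_integral_llr hV hzD] at ez
  obtain ⟨ty, ey⟩ := EReal.toReal_dissipation_identity ey
  obtain ⟨tz, ez⟩ := EReal.toReal_dissipation_identity ez
  rw [hy0, hz0, probMidpoint_self, relEntropy_eq_integral_llr hV hμ,
    relEntropy_eq_integral_llr hV hσD, ← EReal.coe_sub, EReal.abs_def] at hloss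
  have hloss' := ENNReal.toReal_mono (ENNReal.mul_ne_top (by simp) (ENNReal.add_ne_top.2 ⟨ty, tz⟩))
    hloss
  rw [ENNReal.toReal_ofReal (abs_nonneg _), ENNReal.toReal_mul, ENNReal.toReal_add ty tz,
    ENNReal.toReal_inv, ENNReal.toReal_ofNat] at hloss'
  have hgap := integral_llr_add_integral_llr hV hyD hzD
  have habs := neg_le_of_abs_le hloss'
  have k₁ : 0 ≤ (InformationTheory.klDiv ((y T).1 : Measure X)
    (probMidpoint (y T).1 (z T).1 : Measure X)).toReal := ENNReal.toReal_nonneg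
  have k₂ : 0 ≤ (InformationTheory.klDiv ((z T).1 : Measure X)
    (probMidpoint (y T).1 (z T).1 : Measure X)).toReal := ENNReal.toReal_nonneg
  -- adding the energy identities to `hgap` leaves no room for positive divergences
  have h₁ := (ENNReal.toReal_eq_zero_iff _).1 (le_antisymm (by linarith) k₁)
  have h₂ := (ENNReal.toReal_eq_zero_iff _).1 (le_antisymm (by linarith) k₂)
  have t₂ := klDiv_probMidpoint_ne_top (z T).1 (y T).1
  rw [probMidpoint_comm] at t₂
  exact Subtype.ext (Subtype.ext
    ((InformationTheory.klDiv_eq_zero_iff.1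
      (h₁.resolve_right (klDiv_probMidpoint_ne_top _ _))).trans
    (InformationTheory.klDiv_eq_zero_iff.1 (h₂.resolve_right t₂)).symm))
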